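/- Consider threshold testing: $n$ boxes contain i.i.d. values $X_1,\dots,X_n\ge 0$ drawn from a known distribution $F$ on $\mathbb{R}_{\ge 0}$ with finite expectation. An algorithm tests the boxes $1,\dots,n$ in this order, each exactly once: for box $i$ it chooses a threshold $t_i\ge 0$, which may depend on the answers to the earlier tests and on internal randomness (independent of the values), and learns only whether $X_i\ge t_i$. After all $n$ tests it selects one box $\sigma\in\{1,\dots,n\}$ on the basis of all answers and its internal randomness. It is $c$-competitive on $F$ if $\mathbb{E}[X_\sigma]\ge c\cdot\mathbb{E}[\max\{X_1,\dots,X_n\}]$. Theorem. There is no $(1-o(1))$-competitive algorithm for threshold testing: there is no sequence $\varepsilon_n\to 0$ such that, for all sufficiently large $n$ and every distribution $F$ on $\mathbb{R}_{\ge0}$ with finite expectation, some testing algorithm for $n$ boxes is $(1-\varepsilon_n)$-competitive on $F$. The same holds if only continuous (atomless) distributions $F$ are considered. More precisely, there are a constant $c<1$ and an $N\ge 3$ such that for every $n\ge N$, no testing algorithm for $n$ boxes is $c$-competitive on the distribution that takes the values $3$, $2$ and $1$ with probability $1/n$ each and the value $0$ with probability $1-3/n$; and for every $n\ge N$ there is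 also a continuous distribution with finite expectation on which no testing algorithm for $n$ boxes is $c$-competitive. -/

import Mathlib

open MeasureTheory Filter Topology
open scoped NNReal ENNReal

universe u

/-- A (randomized, adaptive) threshold-testing algorithm for `n` boxes. The internal randomness is
a seed drawn from `seedLaw`. Box `i` (boxes are numbered `0, …, n - 1`) is tested at time `i`, once,
with a threshold that may depend on the binary feedback of the tests of the earlier boxes (the list
of answers, oldest first) and on the seed; after all tests one box is selected, depending on the
whole feedback and on the seed. -/
structure TestingAlgorithm (n : ℕ) where
  /-- The space of the internal randomness. -/
  Seed : Type u
  /-- Its measurable sets. -/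
  [measurableSpaceSeed : MeasurableSpace Seed]
  /-- The law of the internal randomness. -/
  seedLaw : Measure Seed
  [isProbabilityMeasure_seedLaw : IsProbabilityMeasure seedLaw]
  /-- The threshold applied to the next box, given the feedback so far. -/
  threshold : List Bool → Seed → ℝ≥0
  measurable_threshold : ∀ h, Measurable (threshold h)
  /-- The selected box, given the feedback of all tests. -/
  select : List Bool → Seed → Fin n
  measurable_select : ∀ h, Measurable (select h)

namespace TestingAlgorithm

attribute [instance] measurableSpaceSeed isProbabilityMeasure_seedLaw

variable {n : ℕ}

/-- The feedback of the tests of the first `k` boxes, when the boxes contain `x` and the seed is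
`s`: the answer for a box is `true` (positive) iff its content is at least the threshold. -/
noncomputable def feedback (A : TestingAlgorithm.{u} n) (x : Fin n → ℝ≥0) (s : A.Seed) : ℕ → List Bool
  | 0 => []
  | k + 1 =>
    if hk : k < n then
      A.feedback x s k ++ [decide (A.threshold (A.feedback x s k) s ≤ x ⟨k, hk⟩)]
    else A.feedback x s k

/-- The box `σ` chosen after all `n` tests. -/
noncomputable def chosen (A : TestingAlgorithm.{u} n) (x : Fin n → ℝ≥0) (s : A.Seed) : Fin n :=
  A.select (A.feedback x s n) s

/-- `E[X_σ]`, for boxes with i.i.d. contents of law `F`, independent of the seed. -/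
noncomputable def expectedReward (A : TestingAlgorithm.{u} n) (F : Measure ℝ≥0) : ℝ≥0∞ :=
  ∫⁻ p : (Fin n → ℝ≥0) × A.Seed, (p.1 (A.chosen p.1 p.2) : ℝ≥0∞)
    ∂((Measure.pi fun _ : Fin n => F).prod A.seedLaw)

end TestingAlgorithm

/-- `E[max {X_1, …, X_n}]` for i.i.d. `X_i` of law `F`. -/
noncomputable def expectedMax (n : ℕ) (F : Measure ℝ≥0) : ℝ≥0∞ :=
  ∫⁻ x : Fin n → ℝ≥0, ((Finset.univ.sup x : ℝ≥0) : ℝ≥0∞) ∂(Measure.pi fun _ : Fin n => F)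

/-- `A` is `c`-competitive on the law `F`: `E[X_σ] ≥ c * E[max {X_1, …, X_n}]`. -/
def TestingAlgorithm.IsCompetitive {n : ℕ} (A : TestingAlgorithm.{u} n) (F : Measure ℝ≥0) (c : ℝ) :
    Prop :=
  ENNReal.ofReal c * expectedMax n F ≤ A.expectedReward F

/-- A probability distribution on `ℝ≥0` with finite expectation. -/
structure IsAdmissible (F : Measure ℝ≥0) : Prop where
  isProbabilityMeasure : IsProbabilityMeasure F
  lintegral_ne_top : ∫⁻ x, (x : ℝ≥0∞) ∂F ≠ ∞

/-- The law of a box that contains `3`, `2` or `1` with probability `1 / n` each, and `0` with the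
remaining probability `1 - 3 / n` (a probability distribution for `n ≥ 3`). -/
noncomputable def hardLaw (n : ℕ) : Measure ℝ≥0 :=
  (n : ℝ≥0∞)⁻¹ • Measure.dirac 3 + (n : ℝ≥0∞)⁻¹ • Measure.dirac 2 +
    (n : ℝ≥0∞)⁻¹ • Measure.dirac 1 + (1 - 3 * (n : ℝ≥0∞)⁻¹) • Measure.dirac 0

/-- There is a `(1 - o(1))`-competitive algorithm for the laws in the class `𝒟`: for some `ε n → 0`,
for all large `n` and every law `F ∈ 𝒟` (known to the algorithm, and possibly depending on `n`), a
testing algorithm for `n` boxes is `(1 - ε n)`-competitive on `F`. -/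
def ExistsAsymptoticallyOptimal (𝒟 : Set (Measure ℝ≥0)) : Prop :=
  ∃ ε : ℕ → ℝ, Tendsto ε atTop (𝓝 0) ∧
    ∀ᶠ n : ℕ in atTop, ∀ F ∈ 𝒟, ∃ A : TestingAlgorithm.{u} n, A.IsCompetitive F (1 - ε n)

/-! Fix the seed and follow the run in which every answer is that for an empty box. Each threshold
`t` on this path meets a dilemma. If `t = 0` or `t > 1`, the answer does not distinguish `1` from
`0`, so a lone `1` in that box goes unnoticed. If `0 < t ≤ 1`, the answer does not distinguish `1`
from `3`; when a later box holds a `2`, the same box is then selected for both values, and one of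
the two choices is wrong.

In the first half of the boxes one kind of threshold is frequent. The first kind gives order `n` bad
inputs with one nonzero entry, the second order `n ^ 2` with two (the `2` lies in the second half).
An input with `m` nonzero entries has probability at least `n⁻ᵐ * exp (-6)`, so a reward of at least
`1` is lost with constant probability (`exists_lossy_finset`). Since the expected maximum is at most
`6`, this is a constant fraction.

For continuous laws, add small uniform noise to the hard law. An algorithm for the noisy law can be
run on the hard law by generating the noise internally (`simulate`), so it gains at most the noise
amplitude. -/

open scoped unitInterval

/-! ### Point masses of the hard law -/

section HardLaw

theorem three_mul_inv_le_one {n : ℕ} (hn : 3 ≤ n) : 3 * (n : ℝ≥0∞)⁻¹ ≤ 1 := by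
  rw [← div_eq_mul_inv]
  exact ENNReal.div_le_of_le_mul (by rw [one_mul]; exact_mod_cast hn)

theorem isProbabilityMeasure_hardLaw {n : ℕ} (hn : 3 ≤ n) : IsProbabilityMeasure (hardLaw n) := by
  constructor
  have h := add_tsub_cancel_of_le (three_mul_inv_le_one hn)
  simp only [hardLaw, Measure.coe_add, Measure.coe_smul, Pi.add_apply, Pi.smul_apply,
    measure_univ, smul_eq_mul, mul_one]
  rw [← two_mul, ← add_one_mul, two_add_one_eq_three]
  exact h

theorem lintegral_hardLaw (n : ℕ) : ∫⁻ x, (x : ℝ≥0∞) ∂(hardLaw n) = 6 * (n : ℝ≥0∞)⁻¹ := by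
  simp only [hardLaw, lintegral_add_measure, lintegral_smul_measure, lintegral_dirac, smul_eq_mul,
    ENNReal.coe_zero, mul_zero, ENNReal.coe_one, ENNReal.coe_ofNat]
  ring

theorem isAdmissible_hardLaw {n : ℕ} (hn : 3 ≤ n) : IsAdmissible (hardLaw n) := by
  refine ⟨isProbabilityMeasure_hardLaw hn, ?_⟩
  rw [lintegral_hardLaw]
  exact ENNReal.mul_ne_top (by simp) (ENNReal.inv_ne_top.2 (by exact_mod_cast by omega))

theorem inv_le_hardLaw_singleton (n : ℕ) {v : ℝ≥0} (hv : v = 1 ∨ v = 2 ∨ v = 3) :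
    (n : ℝ≥0∞)⁻¹ ≤ hardLaw n {v} := by
  rcases hv with rfl | rfl | rfl <;> simp [hardLaw]

theorem le_hardLaw_singleton_zero (n : ℕ) : 1 - 3 * (n : ℝ≥0∞)⁻¹ ≤ hardLaw n {0} := by
  simp [hardLaw]

/-- The inverse of the base is `1 + 3 / (n - 3)`, whose `n`-th power is at most `exp (3n / (n -
3))`; the exponent is at most `6` from `n = 6` on. -/
theorem exp_neg_six_le {n : ℕ} (hn : 6 ≤ n) : Real.exp (-6) ≤ (1 - 3 * (n : ℝ)⁻¹) ^ n := by
  have hn' : (6 : ℝ) ≤ n := by exact_mod_cast hn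
  have h3 : (0 : ℝ) < n - 3 := by linarith
  have key : (1 - 3 * (n : ℝ)⁻¹) = (1 + 3 / (n - 3 : ℝ))⁻¹ := by
    field_simp
    ring
  rw [key, inv_pow, Real.exp_neg]
  gcongr
  calc (1 + 3 / (n - 3 : ℝ)) ^ n ≤ Real.exp (3 / (n - 3 : ℝ)) ^ n := by
        gcongr
        linarith [Real.add_one_le_exp (3 / (n - 3 : ℝ))]
    _ = Real.exp (n * (3 / (n - 3 : ℝ))) := by rw [← Real.exp_nat_mul]
    _ ≤ Real.exp 6 := by
        gcongr
        rw [mul_div_assoc', div_le_iff₀ h3]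
        linarith

theorem le_pi_hardLaw_singleton {n : ℕ} (hn : 6 ≤ n) (S : Finset (Fin n)) (x : Fin n → ℝ≥0)
    (hS : ∀ k ∈ S, x k = 1 ∨ x k = 2 ∨ x k = 3) (h0 : ∀ k ∉ S, x k = 0) :
    ENNReal.ofReal (((n : ℝ)⁻¹) ^ S.card * Real.exp (-6)) ≤
      Measure.pi (fun _ : Fin n => hardLaw n) {x} := by
  have := isProbabilityMeasure_hardLaw (n := n) (by omega)
  have hn' : (6 : ℝ) ≤ n := by exact_mod_cast hn
  have hn0 : (0 : ℝ) < n := by linarith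
  have hp : (0 : ℝ) ≤ 1 - 3 * (n : ℝ)⁻¹ := by
    rw [sub_nonneg, ← div_eq_mul_inv, div_le_one hn0]; linarith
  have hp1 : 1 - 3 * (n : ℝ)⁻¹ ≤ 1 := by
    have : (0 : ℝ) < (n : ℝ)⁻¹ := by positivity
    linarith
  have hinv : ENNReal.ofReal ((n : ℝ)⁻¹) = (n : ℝ≥0∞)⁻¹ := by
    rw [ENNReal.ofReal_inv_of_pos hn0, ENNReal.ofReal_natCast]
  have hz : ENNReal.ofReal (1 - 3 * (n : ℝ)⁻¹) = 1 - 3 * (n : ℝ≥0∞)⁻¹ := by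
    rw [ENNReal.ofReal_sub _ (by positivity), ENNReal.ofReal_mul (by norm_num), hinv]
    simp
  -- A superfluous factor `1 - 3 / n` on `S` makes its exponent `n`, whatever the size of `S`.
  have hterm : ∀ k, ENNReal.ofReal ((if k ∈ S then (n : ℝ)⁻¹ else 1) * (1 - 3 * (n : ℝ)⁻¹)) ≤
      hardLaw n {x k} := by
    intro k
    by_cases hk : k ∈ S
    · rw [if_pos hk]
      refine le_trans ?_ (inv_le_hardLaw_singleton n (hS k hk))
      rw [← hinv]
      exact ENNReal.ofReal_le_ofReal (mul_le_of_le_one_right (by positivity) hp1)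
    · rw [if_neg hk, one_mul, hz, h0 k hk]
      exact le_hardLaw_singleton_zero n
  rw [Measure.pi_singleton]
  refine le_trans ?_ (Finset.prod_le_prod' fun k _ => hterm k)
  rw [← ENNReal.ofReal_prod_of_nonneg (fun k _ => mul_nonneg (by split_ifs <;> positivity) hp),
    Finset.prod_mul_distrib, Finset.prod_ite_mem, Finset.univ_inter, Finset.prod_const,
    Finset.prod_const, Finset.card_univ, Fintype.card_fin]
  exact ENNReal.ofReal_le_ofReal (by gcongr; exact exp_neg_six_le hn)

theorem card_mul_le_pi_hardLaw {n : ℕ} (hn : 6 ≤ n) (m : ℕ) (C : Finset (Fin n → ℝ≥0))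
    (hC : ∀ x ∈ C, ∃ S : Finset (Fin n), S.card = m ∧
      (∀ k ∈ S, x k = 1 ∨ x k = 2 ∨ x k = 3) ∧ ∀ k ∉ S, x k = 0) :
    ENNReal.ofReal (C.card * (((n : ℝ)⁻¹) ^ m * Real.exp (-6))) ≤
      Measure.pi (fun _ : Fin n => hardLaw n) (C : Set (Fin n → ℝ≥0)) := by
  rw [← sum_measure_singleton, ENNReal.ofReal_mul (by positivity), ENNReal.ofReal_natCast,
    ← nsmul_eq_mul]
  refine Finset.card_nsmul_le_sum _ _ _ fun x hx => ?_
  obtain ⟨S, rfl, hS, h0⟩ := hC x hx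
  exact le_pi_hardLaw_singleton hn S x hS h0

end HardLaw

/-! ### Bad inputs for a fixed seed -/

namespace TestingAlgorithm

variable {n : ℕ} (A : TestingAlgorithm.{u} n) (s : A.Seed)

/-- Until the first differing answer the histories coincide, so it suffices to compare answers to
the thresholds of the run on `x`. -/
theorem feedback_congr {x y : Fin n → ℝ≥0} {m : ℕ}
    (h : ∀ k (hk : k < n), k < m → (A.threshold (A.feedback x s k) s ≤ x ⟨k, hk⟩ ↔
      A.threshold (A.feedback x s k) s ≤ y ⟨k, hk⟩)) :
    A.feedback x s m = A.feedback y s m := by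
  induction m with
  | zero => rfl
  | succ m ih =>
    have ih' := ih fun k hk hkm => h k hk (by omega)
    by_cases hm : m < n
    · simp only [feedback, hm, dif_pos]
      rw [← ih']
      simp only [h m hm (by omega)]
    · simp only [feedback, hm, dif_neg, not_false_eq_true, ih']

/-- A threshold `0` accepts both `0` and `1`, one above `1` rejects both: the run never leaves the
all-zero path. -/
theorem chosen_single_of_not_mem {i : Fin n}
    (hi : ¬ (0 < A.threshold (A.feedback 0 s i) s ∧ A.threshold (A.feedback 0 s i) s ≤ 1)) :
    A.chosen (Pi.single i 1) s = A.chosen 0 s := by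
  unfold chosen
  rw [A.feedback_congr s (x := 0) (y := Pi.single i 1)]
  intro k hk _
  by_cases hki : (⟨k, hk⟩ : Fin n) = i
  · subst hki
    simp only [Pi.zero_apply, Pi.single_eq_same, nonpos_iff_eq_zero]
    rw [pos_iff_ne_zero] at hi
    refine ⟨fun h => by rw [h]; exact zero_le_one, fun h => by_contra fun h' => hi ⟨h', h⟩⟩
  · simp [Pi.single_eq_of_ne hki]

/-- As `j` comes after `i`, box `i` is tested with its threshold on the all-zero path, which both
`1` and `3` pass. -/
theorem chosen_update_single_eq {i j : Fin n} (hij : i < j)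
    (hi : 0 < A.threshold (A.feedback 0 s i) s ∧ A.threshold (A.feedback 0 s i) s ≤ 1) :
    A.chosen (Function.update (Pi.single j 2 : Fin n → ℝ≥0) i 1) s =
      A.chosen (Function.update (Pi.single j 2 : Fin n → ℝ≥0) i 3) s := by
  unfold chosen
  rw [A.feedback_congr s]
  intro k hk _
  by_cases hki : (⟨k, hk⟩ : Fin n) = i
  · have h0 : A.feedback 0 s i = A.feedback (Function.update (Pi.single j 2 : Fin n → ℝ≥0) i 1) s i := by
      apply A.feedback_congr
      intro l hl hli
      have h1 : (⟨l, hl⟩ : Fin n) ≠ i := fun h => by rw [← h] at hli; exact lt_irrefl _ hli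
      have h2 : (⟨l, hl⟩ : Fin n) ≠ j := by
        intro h
        rw [← h] at hij
        exact lt_asymm hij hli
      rw [Function.update_of_ne h1, Pi.single_eq_of_ne h2, Pi.zero_apply]
    rw [h0] at hi
    have hik : (i : ℕ) = k := by rw [← hki]
    rw [hik] at hi
    rw [hki, Function.update_self, Function.update_self]
    exact ⟨fun _ => hi.2.trans (by norm_num), fun _ => hi.2⟩
  · rw [Function.update_of_ne hki, Function.update_of_ne hki]

/-- If the common choice is `i`, value `1` there loses to the `2` at `j`; otherwise value `3` is
missed and all other boxes hold at most `2`. -/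
theorem exists_lossy_update_single {i j : Fin n} (hij : i < j)
    (hi : 0 < A.threshold (A.feedback 0 s i) s ∧ A.threshold (A.feedback 0 s i) s ≤ 1) :
    ∃ v : ℝ≥0, (v = 1 ∨ v = 3) ∧ Function.update (Pi.single j 2 : Fin n → ℝ≥0) i v
        (A.chosen (Function.update (Pi.single j 2 : Fin n → ℝ≥0) i v) s) + 1 ≤
      Finset.univ.sup (Function.update (Pi.single j 2 : Fin n → ℝ≥0) i v) := by
  by_cases hc : A.chosen (Function.update (Pi.single j 2 : Fin n → ℝ≥0) i 1) s = i
  · refine ⟨1, Or.inl rfl, ?_⟩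
    rw [hc, Function.update_self]
    refine le_trans ?_ (Finset.le_sup (Finset.mem_univ j))
    rw [Function.update_of_ne hij.ne', Pi.single_eq_same]
    norm_num
  · refine ⟨3, Or.inr rfl, ?_⟩
    rw [A.chosen_update_single_eq s hij hi] at hc
    refine le_trans ?_ (Finset.le_sup (Finset.mem_univ i))
    rw [Function.update_self, Function.update_of_ne hc, Pi.single_apply]
    split_ifs <;> norm_num

/-- For every seed, with constant probability the chosen box falls short of the maximum by `1`. -/
theorem exists_lossy_finset (hn : 8 ≤ n) :
    ∃ C : Finset (Fin n → ℝ≥0), (∀ x ∈ C, x (A.chosen x s) + 1 ≤ Finset.univ.sup x) ∧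
      ENNReal.ofReal (Real.exp (-6) / 16) ≤
        Measure.pi (fun _ : Fin n => hardLaw n) (C : Set (Fin n → ℝ≥0)) := by
  classical
  have hn0 : (0 : ℝ) < n := by exact_mod_cast (by omega : 0 < n)
  have hexp := Real.exp_pos (-6)
  let P : Fin n → Prop := fun i =>
    0 < A.threshold (A.feedback 0 s i) s ∧ A.threshold (A.feedback 0 s i) s ≤ 1
  let mid : Fin n := ⟨n / 2, by omega⟩
  have hL : (Finset.Iio mid).card = n / 2 := Fin.card_Iio _
  have hU : (Finset.Ici mid).card = n - n / 2 := Fin.card_Ici _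
  have hsplit := Finset.card_filter_add_card_filter_not (s := Finset.Iio mid) P
  set G := (Finset.Iio mid).filter P with hG
  set B := (Finset.Iio mid).filter fun i => ¬ P i with hB
  -- The margin `8` pays for erasing one box from `B`; in the other case `n / 8 ≤ G.card` still
  -- holds because `8 ≤ n`.
  by_cases hBcard : n + 8 ≤ 8 * B.card
  · set D := B.erase (A.chosen 0 s) with hD
    have hDcard : n ≤ 8 * D.card := by
      have : B.card - 1 ≤ D.card := Finset.pred_card_le_card_erase
      omega
    have hinj : Function.Injective fun i : Fin n => (Pi.single i 1 : Fin n → ℝ≥0) := by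
      intro i j h
      by_contra hij
      have := congrFun h i
      simp [Pi.single_eq_of_ne hij] at this
    refine ⟨D.image fun i => Pi.single i 1, ?_, ?_⟩
    · intro x hx
      obtain ⟨i, hi, rfl⟩ := Finset.mem_image.1 hx
      obtain ⟨hne, hiB⟩ := Finset.mem_erase.1 hi
      rw [A.chosen_single_of_not_mem s (Finset.mem_filter.1 hiB).2,
        Pi.single_eq_of_ne (Ne.symm hne), zero_add]
      refine le_trans ?_ (Finset.le_sup (Finset.mem_univ i))
      rw [Pi.single_eq_same]
    · refine le_trans ?_ (card_mul_le_pi_hardLaw (by omega) 1 _ ?_)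
      · rw [Finset.card_image_of_injective _ hinj]
        apply ENNReal.ofReal_le_ofReal
        have h : (n : ℝ) ≤ 8 * D.card := by exact_mod_cast hDcard
        have h' : (1 / 8 : ℝ) ≤ D.card * (n : ℝ)⁻¹ := by
          rw [← div_eq_mul_inv, le_div_iff₀ hn0]; linarith
        nlinarith
      · intro x hx
        obtain ⟨i, hi, rfl⟩ := Finset.mem_image.1 hx
        refine ⟨{i}, by simp, by simp, fun k hk => ?_⟩
        exact Pi.single_eq_of_ne (by simpa using hk) _
  · have hlt : ∀ p ∈ G ×ˢ Finset.Ici mid, p.1 < p.2 ∧ P p.1 := by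
      intro p hp
      obtain ⟨h1, h2⟩ := Finset.mem_product.1 hp
      obtain ⟨h1, h3⟩ := Finset.mem_filter.1 h1
      exact ⟨(Finset.mem_Iio.1 h1).trans_le (Finset.mem_Ici.1 h2), h3⟩
    have hex : ∀ p : Fin n × Fin n, ∃ v : ℝ≥0, p ∈ G ×ˢ Finset.Ici mid → (v = 1 ∨ v = 3) ∧
        Function.update (Pi.single p.2 2 : Fin n → ℝ≥0) p.1 v
          (A.chosen (Function.update (Pi.single p.2 2 : Fin n → ℝ≥0) p.1 v) s) + 1 ≤
        Finset.univ.sup (Function.update (Pi.single p.2 2 : Fin n → ℝ≥0) p.1 v) := by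
      intro p
      by_cases hp : p ∈ G ×ˢ Finset.Ici mid
      · obtain ⟨v, hv⟩ := A.exists_lossy_update_single s (hlt p hp).1 (hlt p hp).2
        exact ⟨v, fun _ => hv⟩
      · exact ⟨0, fun h => absurd h hp⟩
    choose v hv using hex
    let f : Fin n × Fin n → Fin n → ℝ≥0 := fun p => Function.update (Pi.single p.2 2 : Fin n → ℝ≥0) p.1 (v p)
    have hf1 : ∀ p, f p p.1 = v p := fun p => Function.update_self ..
    have hf2 : ∀ p ∈ G ×ˢ Finset.Ici mid, f p p.2 = 2 := fun p hp => by
      simp [f, Function.update_of_ne (hlt p hp).1.ne']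
    have hf0 : ∀ p k, k ≠ p.1 → k ≠ p.2 → f p k = 0 := fun p k h1 h2 => by
      simp [f, Function.update_of_ne h1, Pi.single_eq_of_ne h2]
    -- The pair can be read off the input: `p.2` is where the value `2` sits, `p.1` where `1` or `3`
    -- sits.
    have hinj : Set.InjOn f (G ×ˢ Finset.Ici mid : Finset (Fin n × Fin n)) := by
      intro p hp q hq hpq
      have hp := Finset.mem_coe.1 hp
      have hq := Finset.mem_coe.1 hq
      have h2 : q.2 = p.2 := by
        by_contra hne
        have h := hf2 q hq
        rw [← hpq] at h
        by_cases h1 : q.2 = p.1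
        · rw [h1, hf1] at h
          rcases (hv p hp).1 with h' | h' <;> rw [h'] at h <;> norm_num at h
        · rw [hf0 p _ h1 hne] at h
          norm_num at h
      have h1 : q.1 = p.1 := by
        by_contra hne
        have h := hf1 q
        rw [← hpq, hf0 p _ hne (h2 ▸ (hlt q hq).1.ne)] at h
        rcases (hv q hq).1 with h' | h' <;> rw [h'] at h <;> norm_num at h
      exact Prod.ext h1.symm h2.symm
    refine ⟨(G ×ˢ Finset.Ici mid).image f, ?_, ?_⟩
    · intro x hx
      obtain ⟨p, hp, rfl⟩ := Finset.mem_image.1 hx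
      exact (hv p hp).2
    · refine le_trans ?_ (card_mul_le_pi_hardLaw (by omega) 2 _ ?_)
      · rw [Finset.card_image_of_injOn hinj, Finset.card_product]
        apply ENNReal.ofReal_le_ofReal
        have h1 : (n : ℝ) ≤ 8 * G.card := by exact_mod_cast (by omega : n ≤ 8 * G.card)
        have h2 : (n : ℝ) ≤ 2 * (Finset.Ici mid).card := by
          exact_mod_cast (by omega : n ≤ 2 * (Finset.Ici mid).card)
        have h1' : (1 / 8 : ℝ) ≤ G.card * (n : ℝ)⁻¹ := by
          rw [← div_eq_mul_inv, le_div_iff₀ hn0]; linarith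
        have h2' : (1 / 2 : ℝ) ≤ (Finset.Ici mid).card * (n : ℝ)⁻¹ := by
          rw [← div_eq_mul_inv, le_div_iff₀ hn0]; linarith
        have h3 := mul_le_mul h1' h2' (by norm_num) (le_trans (by norm_num) h1')
        push_cast
        calc Real.exp (-6) / 16 = (1 / 8 * (1 / 2)) * Real.exp (-6) := by ring
          _ ≤ _ := mul_le_mul_of_nonneg_right h3 hexp.le
          _ = _ := by ring
      · intro x hx
        obtain ⟨p, hp, rfl⟩ := Finset.mem_image.1 hx
        refine ⟨{p.1, p.2}, Finset.card_pair (hlt p hp).1.ne, fun k hk => ?_, fun k hk => ?_⟩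
        · rcases Finset.mem_insert.1 hk with rfl | hk
          · rw [hf1]
            exact (hv p hp).1.imp_right Or.inr
          · rw [Finset.mem_singleton.1 hk, hf2 p hp]
            exact Or.inr (Or.inl rfl)
        · simp only [Finset.mem_insert, Finset.mem_singleton, not_or] at hk
          exact hf0 p k hk.1 hk.2

end TestingAlgorithm

/-! ### Measurability of the reward -/

namespace TestingAlgorithm

variable {n : ℕ} (A : TestingAlgorithm.{u} n)

/-- `Q` is general so that the last answer can be absorbed into it, leaving a shorter history; each
new set splits according to that answer. -/
theorem measurableSet_feedback_mem (k : ℕ) (Q : List Bool → Set ((Fin n → ℝ≥0) × A.Seed))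
    (hQ : ∀ h, MeasurableSet (Q h)) : MeasurableSet {p | p ∈ Q (A.feedback p.1 p.2 k)} := by
  induction k generalizing Q with
  | zero => exact hQ []
  | succ k ih =>
    by_cases hk : k < n
    · simp only [feedback, hk, dif_pos]
      refine ih (fun h => {p | p ∈ Q (h ++ [decide (A.threshold h p.2 ≤ p.1 ⟨k, hk⟩)])})
        fun h => ?_
      have hM : MeasurableSet
          {p : (Fin n → ℝ≥0) × A.Seed | A.threshold h p.2 ≤ p.1 ⟨k, hk⟩} :=
        measurableSet_le ((A.measurable_threshold h).comp measurable_snd)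
          ((measurable_pi_apply _).comp measurable_fst)
      convert (hM.inter (hQ (h ++ [true]))).union (hM.compl.inter (hQ (h ++ [false]))) using 1
      ext p
      by_cases hp : A.threshold h p.2 ≤ p.1 ⟨k, hk⟩ <;> simp [hp]
    · simp only [feedback, hk, dif_neg, not_false_eq_true]
      exact ih Q hQ

theorem measurable_reward :
    Measurable fun p : (Fin n → ℝ≥0) × A.Seed => p.1 (A.chosen p.1 p.2) := by
  intro t ht
  refine A.measurableSet_feedback_mem n (fun h => {p | p.1 (A.select h p.2) ∈ t}) fun h => ?_
  have hm : Measurable fun q : (Fin n → ℝ≥0) × Fin n => q.1 q.2 :=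
    measurable_from_prod_countable_left fun i => measurable_pi_apply i
  exact hm.comp (measurable_fst.prodMk ((A.measurable_select h).comp measurable_snd)) ht

theorem length_feedback (x : Fin n → ℝ≥0) (s : A.Seed) {k : ℕ} (hk : k ≤ n) :
    (A.feedback x s k).length = k := by
  induction k with
  | zero => rfl
  | succ k ih => simp [feedback, (by omega : k < n), ih (by omega)]

end TestingAlgorithm

/-! ### Additive loss on the hard law -/

theorem expectedMax_hardLaw_le {n : ℕ} (hn : 3 ≤ n) : expectedMax n (hardLaw n) ≤ 6 := by
  have := isProbabilityMeasure_hardLaw hn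
  calc expectedMax n (hardLaw n)
      ≤ ∫⁻ x : Fin n → ℝ≥0, ∑ i, (x i : ℝ≥0∞) ∂(Measure.pi fun _ : Fin n => hardLaw n) := by
        refine lintegral_mono fun x => ?_
        rw [← ENNReal.ofNNReal_finsetSum, ENNReal.coe_le_coe]
        exact Finset.sup_le fun i hi => Finset.single_le_sum (fun _ _ => zero_le) hi
    _ = ∑ i : Fin n, ∫⁻ x, (x : ℝ≥0∞) ∂(hardLaw n) := by
        rw [lintegral_finsetSum _ fun i _ => by fun_prop]
        exact Finset.sum_congr rfl fun i _ =>
          (measurePreserving_eval (fun _ : Fin n => hardLaw n) i).lintegral_comp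
            (f := fun x : ℝ≥0 => (x : ℝ≥0∞)) (by fun_prop)
    _ = 6 := by
        rw [Finset.sum_const, Finset.card_univ, Fintype.card_fin, nsmul_eq_mul, lintegral_hardLaw,
          mul_left_comm, ENNReal.mul_inv_cancel (by exact_mod_cast by omega) (by simp), mul_one]

/-- No algorithm comes within `exp (-6) / 16` of the expected maximum on `hardLaw n`. -/
theorem TestingAlgorithm.expectedReward_hardLaw_add_le {n : ℕ} (hn : 8 ≤ n)
    (A : TestingAlgorithm.{u} n) :
    A.expectedReward (hardLaw n) + ENNReal.ofReal (Real.exp (-6) / 16) ≤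
      expectedMax n (hardLaw n) := by
  have := isProbabilityMeasure_hardLaw (n := n) (by omega)
  have hm := A.measurable_reward
  have key : ∀ s : A.Seed,
      (∫⁻ x : Fin n → ℝ≥0, (x (A.chosen x s) : ℝ≥0∞) ∂(Measure.pi fun _ : Fin n => hardLaw n)) +
        ENNReal.ofReal (Real.exp (-6) / 16) ≤ expectedMax n (hardLaw n) := by
    intro s
    -- `C` varies with the seed, but the bound does not, so no measurable choice of `C` is needed.
    obtain ⟨C, hC, hμ⟩ := A.exists_lossy_finset s hn
    have hCm : MeasurableSet (C : Set (Fin n → ℝ≥0)) := C.measurableSet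
    refine (add_le_add_right hμ _).trans ?_
    rw [← lintegral_indicator_one hCm,
      ← lintegral_add_right _ (measurable_one.indicator hCm)]
    refine lintegral_mono fun x => ?_
    by_cases hx : x ∈ C
    · rw [Set.indicator_of_mem (by exact_mod_cast hx), Pi.one_apply]
      exact (ENNReal.coe_add _ _).symm.trans_le (ENNReal.coe_le_coe.2 (hC x hx))
    · rw [Set.indicator_of_notMem (by exact_mod_cast hx), add_zero]
      exact ENNReal.coe_le_coe.2 (Finset.le_sup (f := x) (Finset.mem_univ _))
  calc A.expectedReward (hardLaw n) + ENNReal.ofReal (Real.exp (-6) / 16)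
      = ∫⁻ s, ((∫⁻ x : Fin n → ℝ≥0, (x (A.chosen x s) : ℝ≥0∞)
          ∂(Measure.pi fun _ : Fin n => hardLaw n)) + ENNReal.ofReal (Real.exp (-6) / 16))
          ∂A.seedLaw := by
        rw [lintegral_add_right _ measurable_const, lintegral_const, measure_univ, mul_one,
          TestingAlgorithm.expectedReward, lintegral_prod_symm' _ (by fun_prop)]
    _ ≤ ∫⁻ _, expectedMax n (hardLaw n) ∂A.seedLaw := lintegral_mono key
    _ = expectedMax n (hardLaw n) := by rw [lintegral_const, measure_univ, mul_one]

/-! ### Smoothing a law by uniform noise -/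

section Perturbation

/-- The value `y`, perturbed by the noise `δ * u`. -/
noncomputable def perturb (δ : ℝ≥0) (p : ℝ≥0 × I) : ℝ≥0 := p.1 + δ * Real.toNNReal p.2

theorem measurable_perturb (δ : ℝ≥0) : Measurable (perturb δ) := by
  unfold perturb
  fun_prop

theorem perturb_le (δ : ℝ≥0) (p : ℝ≥0 × I) : perturb δ p ≤ p.1 + δ := by
  unfold perturb
  gcongr
  exact mul_le_of_le_one_right zero_le (Real.toNNReal_le_one.2 p.2.2.2)

/-- The law of `Y + δ * U`, where `Y` has law `F` and `U` is independent and uniform on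
`[0, 1]`. -/
noncomputable def perturbedLaw (δ : ℝ≥0) (F : Measure ℝ≥0) : Measure ℝ≥0 :=
  (F.prod volume).map (perturb δ)

variable {δ : ℝ≥0} {F : Measure ℝ≥0}

instance [IsProbabilityMeasure F] : IsProbabilityMeasure (perturbedLaw δ F) :=
  Measure.isProbabilityMeasure_map (measurable_perturb δ).aemeasurable

theorem perturbedLaw_singleton (hδ : δ ≠ 0) (x : ℝ≥0) : perturbedLaw δ F {x} = 0 := by
  rw [perturbedLaw, Measure.map_apply (measurable_perturb δ) (measurableSet_singleton x),
    Measure.measure_prod_null (measurable_perturb δ (measurableSet_singleton x))]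
  refine Eventually.of_forall fun y => Set.Subsingleton.measure_zero ?_ _
  intro u hu v hv
  have hu' : perturb δ (y, u) = x := hu
  have hv' : perturb δ (y, v) = x := hv
  have h := hu'.trans hv'.symm
  simp only [perturb] at h
  have h' := mul_left_cancel₀ hδ (add_left_cancel h)
  exact Subtype.ext ((Real.toNNReal_eq_toNNReal_iff u.2.1 v.2.1).1 h')

theorem isAdmissible_perturbedLaw (hF : IsAdmissible F) : IsAdmissible (perturbedLaw δ F) := by
  have := hF.isProbabilityMeasure
  refine ⟨inferInstance, ?_⟩
  rw [perturbedLaw, lintegral_map (by fun_prop) (measurable_perturb δ)]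
  refine ne_top_of_le_ne_top (b := ∫⁻ x, (x : ℝ≥0∞) ∂F + δ)
    (ENNReal.add_ne_top.2 ⟨hF.lintegral_ne_top, ENNReal.coe_ne_top⟩) ?_
  calc ∫⁻ p, (perturb δ p : ℝ≥0∞) ∂(F.prod volume)
      ≤ ∫⁻ p : ℝ≥0 × I, ((p.1 : ℝ≥0∞) + δ) ∂(F.prod volume) :=
        lintegral_mono fun p =>
          (ENNReal.coe_le_coe.2 (perturb_le δ p)).trans_eq (ENNReal.coe_add _ _)
    _ = ∫⁻ x, (x : ℝ≥0∞) ∂F + δ := by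
        rw [lintegral_add_right _ measurable_const, lintegral_const, measure_univ, mul_one,
          measurePreserving_fst.lintegral_comp (f := fun x : ℝ≥0 => (x : ℝ≥0∞)) (by fun_prop)]

theorem measurePreserving_perturb (n : ℕ) (δ : ℝ≥0) (F : Measure ℝ≥0) [IsProbabilityMeasure F] :
    MeasurePreserving
      (fun (p : (Fin n → ℝ≥0) × (Fin n → I)) (i : Fin n) => perturb δ (p.1 i, p.2 i))
      ((Measure.pi fun _ => F).prod (Measure.pi fun _ => volume))
      (Measure.pi fun _ => perturbedLaw δ F) :=
  (measurePreserving_pi (fun _ : Fin n => F.prod (volume : Measure I))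
    (fun _ => perturbedLaw δ F)
    (fun _ => (⟨measurable_perturb δ, rfl⟩ :
      MeasurePreserving (perturb δ) (F.prod (volume : Measure I)) (perturbedLaw δ F)))).comp
    (MeasurePreserving.symm _ (measurePreserving_arrowProdEquivProdArrow ℝ≥0 I (Fin n)
      (fun _ => F) (fun _ => volume)))

theorem expectedMax_le_expectedMax_perturbedLaw (n : ℕ) [IsProbabilityMeasure F] :
    expectedMax n F ≤ expectedMax n (perturbedLaw δ F) := by
  rw [expectedMax, expectedMax, ← (measurePreserving_perturb n δ F).lintegral_comp (by fun_prop),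
    ← (measurePreserving_fst (μ := Measure.pi fun _ : Fin n => F)
      (ν := Measure.pi fun _ : Fin n => (volume : Measure I))).lintegral_comp (by fun_prop)]
  refine lintegral_mono fun p => ENNReal.coe_le_coe.2 (Finset.sup_mono_fun fun i _ => ?_)
  exact le_self_add

end Perturbation

/-! ### Simulating the noise -/

namespace TestingAlgorithm

variable {n : ℕ} (A : TestingAlgorithm.{u} n)

/-- The algorithm that adds independent noise to the boxes by itself and runs `A` on the
result. -/
noncomputable def simulate (δ : ℝ≥0) : TestingAlgorithm.{u} n where
  Seed := (Fin n → I) × A.Seed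
  seedLaw := (Measure.pi fun _ => volume).prod A.seedLaw
  -- Moving the noise to the threshold preserves the answer, even with truncated subtraction, as
  -- contents are nonnegative. The history length is the index of the box under test, so the default
  -- `0` is never used in a run.
  threshold h s := A.threshold h s.2 -
    if hk : h.length < n then δ * Real.toNNReal (s.1 ⟨h.length, hk⟩) else 0
  measurable_threshold h := by
    refine ((A.measurable_threshold h).comp measurable_snd).sub ?_
    split_ifs <;> fun_prop
  select h s := A.select h s.2
  measurable_select h := (A.measurable_select h).comp measurable_snd

theorem feedback_simulate (δ : ℝ≥0) (y : Fin n → ℝ≥0) (v : Fin n → I) (s : A.Seed) (k : ℕ) :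
    (A.simulate δ).feedback y (v, s) k = A.feedback (fun i => perturb δ (y i, v i)) s k := by
  induction k with
  | zero => rfl
  | succ k ih =>
    by_cases hk : k < n
    · simp only [feedback, hk, dif_pos]
      rw [ih]
      refine congrArg (_ ++ [·]) (decide_eq_decide.2 ?_)
      simp only [simulate, A.length_feedback _ s hk.le, hk, dif_pos, tsub_le_iff_right, perturb]
    · simp only [feedback, hk, dif_neg, not_false_eq_true, ih]

theorem chosen_simulate (δ : ℝ≥0) (y : Fin n → ℝ≥0) (v : Fin n → I) (s : A.Seed) :
    (A.simulate δ).chosen y (v, s) = A.chosen (fun i => perturb δ (y i, v i)) s := by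
  unfold chosen
  rw [feedback_simulate]
  rfl

theorem expectedReward_perturbedLaw_le (δ : ℝ≥0) (F : Measure ℝ≥0) [IsProbabilityMeasure F] :
    A.expectedReward (perturbedLaw δ F) ≤ (A.simulate δ).expectedReward F + δ := by
  have hmp := (measurePreserving_perturb n δ F).prod (MeasurePreserving.id A.seedLaw)
  have hm := A.measurable_reward
  have hm' := (A.simulate δ).measurable_reward
  have hassoc : MeasurePreserving
      (MeasurableEquiv.prodAssoc : ((Fin n → ℝ≥0) × (Fin n → I)) × A.Seed ≃ᵐ _)
      (((Measure.pi fun _ => F).prod (Measure.pi fun _ => volume)).prod A.seedLaw)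
      ((Measure.pi fun _ => F).prod (A.simulate δ).seedLaw) :=
    measurePreserving_prodAssoc _ _ _
  calc A.expectedReward (perturbedLaw δ F)
      = ∫⁻ q, ((perturb δ (q.1.1 ((A.simulate δ).chosen q.1.1 (q.1.2, q.2)),
          q.1.2 ((A.simulate δ).chosen q.1.1 (q.1.2, q.2))) : ℝ≥0) : ℝ≥0∞)
        ∂(((Measure.pi fun _ => F).prod (Measure.pi fun _ => volume)).prod A.seedLaw) := by
        rw [expectedReward, ← hmp.lintegral_comp (by fun_prop)]
        simp only [chosen_simulate]
        rfl
    _ ≤ ∫⁻ q, (((q.1.1 ((A.simulate δ).chosen q.1.1 (q.1.2, q.2)) : ℝ≥0) : ℝ≥0∞) + δ)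
        ∂(((Measure.pi fun _ => F).prod (Measure.pi fun _ => volume)).prod A.seedLaw) :=
        lintegral_mono fun q =>
          (ENNReal.coe_le_coe.2 (perturb_le δ _)).trans_eq (ENNReal.coe_add _ _)
    _ = (A.simulate δ).expectedReward F + δ := by
        rw [lintegral_add_right _ measurable_const, lintegral_const, measure_univ, mul_one,
          expectedReward]
        exact congrArg (· + (δ : ℝ≥0∞)) (hassoc.lintegral_comp
          (f := fun p => ((p.1 ((A.simulate δ).chosen p.1 p.2) : ℝ≥0) : ℝ≥0∞)) (by fun_prop))

end TestingAlgorithm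

/-! ### From additive to multiplicative loss -/

theorem TestingAlgorithm.IsCompetitive.mono {n : ℕ} {A : TestingAlgorithm.{u} n} {F : Measure ℝ≥0}
    {c d : ℝ} (h : A.IsCompetitive F d) (hcd : c ≤ d) : A.IsCompetitive F c :=
  le_trans (mul_le_mul_left (ENNReal.ofReal_le_ofReal hcd) _) h

theorem not_existsAsymptoticallyOptimal {𝒟 : Set (Measure ℝ≥0)} {c : ℝ} (hc : c < 1) {N : ℕ}
    (h : ∀ n, N ≤ n → ∃ F ∈ 𝒟, ∀ A : TestingAlgorithm.{u} n, ¬ A.IsCompetitive F c) :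
    ¬ ExistsAsymptoticallyOptimal.{u} 𝒟 := by
  rintro ⟨ε, hε, hA⟩
  obtain ⟨n, hn, hεn, hNn⟩ :=
    (hA.and ((hε.eventually_lt_const (sub_pos.2 hc)).and (eventually_ge_atTop N))).exists
  obtain ⟨F, hF, hFA⟩ := h n hNn
  obtain ⟨A, hAF⟩ := hn F hF
  exact hFA A (hAF.mono (by linarith))

/-- Half of the loss `κ` is reserved for the noise. The other half exceeds `κ / 24 * M`, which is at
most `κ / 4`. -/
theorem lt_mul_of_add_le {κ : ℝ} (hκ0 : 0 < κ) (hκ : κ ≤ 1) {R M : ℝ≥0∞} (hM : M ≤ 6)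
    (h : R + ENNReal.ofReal κ ≤ M) :
    R + ENNReal.ofReal (κ / 2) < ENNReal.ofReal (1 - κ / 24) * M := by
  have hMt : M ≠ ∞ := ne_top_of_le_ne_top (by simp) hM
  have hRt : R ≠ ∞ := ne_top_of_le_ne_top hMt (le_self_add.trans h)
  lift M to ℝ≥0 using hMt
  lift R to ℝ≥0 using hRt
  have hM' : (M : ℝ) ≤ 6 := by exact_mod_cast hM
  have h' : (R : ℝ) + κ ≤ M := by
    have := ENNReal.toReal_mono ENNReal.coe_ne_top h
    rwa [ENNReal.toReal_add ENNReal.coe_ne_top ENNReal.ofReal_ne_top,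
      ENNReal.toReal_ofReal hκ0.le, ENNReal.coe_toReal, ENNReal.coe_toReal] at this
  rw [← ENNReal.ofReal_coe_nnreal, ← ENNReal.ofReal_coe_nnreal,
    ← ENNReal.ofReal_add (by positivity) (by positivity), ← ENNReal.ofReal_mul (by linarith)]
  refine (ENNReal.ofReal_lt_ofReal_iff_of_nonneg (by positivity)).2 ?_
  nlinarith

theorem theorem8 :
    -- no `(1 - o(1))`-competitive algorithm, neither for all laws nor for all continuous laws
    ¬ ExistsAsymptoticallyOptimal.{u} {F | IsAdmissible F} ∧
    ¬ ExistsAsymptoticallyOptimal.{u} {F | IsAdmissible F ∧ (∀ x, F {x} = 0)} ∧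
    -- a constant fraction is lost for every large `n`, on the instance with values `3, 2, 1, 0`
    -- and also on some continuous law
    ∃ c : ℝ, c < 1 ∧ ∃ N : ℕ, 3 ≤ N ∧ ∀ n : ℕ, N ≤ n →
      (IsAdmissible (hardLaw n) ∧
        ∀ A : TestingAlgorithm.{u} n, ¬ A.IsCompetitive (hardLaw n) c) ∧
      ∃ F : Measure ℝ≥0, IsAdmissible F ∧ (∀ x, F {x} = 0) ∧
        ∀ A : TestingAlgorithm.{u} n, ¬ A.IsCompetitive F c := by
  set κ : ℝ := Real.exp (-6) / 16 with hκ
  have hκ0 : 0 < κ := by positivity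
  have hκ1 : κ ≤ 1 := by
    have : Real.exp (-6) ≤ 1 := Real.exp_le_one_iff.2 (by norm_num)
    linarith
  have hc : 1 - κ / 24 < 1 := by linarith
  have main : ∀ n : ℕ, 8 ≤ n → (IsAdmissible (hardLaw n) ∧
        ∀ A : TestingAlgorithm.{u} n, ¬ A.IsCompetitive (hardLaw n) (1 - κ / 24)) ∧
      ∃ F : Measure ℝ≥0, IsAdmissible F ∧ (∀ x, F {x} = 0) ∧
        ∀ A : TestingAlgorithm.{u} n, ¬ A.IsCompetitive F (1 - κ / 24) := by
    intro n hn
    have hadm := isAdmissible_hardLaw (n := n) (by omega)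
    have := hadm.isProbabilityMeasure
    have hM := expectedMax_hardLaw_le (n := n) (by omega)
    have hlt : ∀ A : TestingAlgorithm.{u} n,
        A.expectedReward (hardLaw n) + ENNReal.ofReal (κ / 2) <
          ENNReal.ofReal (1 - κ / 24) * expectedMax n (hardLaw n) := fun A =>
      lt_mul_of_add_le hκ0 hκ1 hM (A.expectedReward_hardLaw_add_le hn)
    refine ⟨⟨hadm, fun A => not_le.2 (le_self_add.trans_lt (hlt A))⟩,
      perturbedLaw (κ / 2).toNNReal (hardLaw n), isAdmissible_perturbedLaw hadm,
      perturbedLaw_singleton (Real.toNNReal_pos.2 (by linarith)).ne', fun A => not_le.2 ?_⟩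
    calc A.expectedReward (perturbedLaw (κ / 2).toNNReal (hardLaw n))
        ≤ _ := A.expectedReward_perturbedLaw_le _ _
      _ < _ := hlt _
      _ ≤ _ := mul_le_mul_right (expectedMax_le_expectedMax_perturbedLaw n) _
  refine ⟨not_existsAsymptoticallyOptimal hc (N := 8) fun n hn => ⟨_, (main n hn).1⟩,
    not_existsAsymptoticallyOptimal hc (N := 8) fun n hn => ?_, _, hc, 8, by norm_num, main⟩
  obtain ⟨F, h1, h2, h3⟩ := (main n hn).2
  exact ⟨F, ⟨h1, h2⟩, h3⟩
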